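/- Let $\mathbb{T}=\{z_1+z_2\mathbf{i_2} : z_1,z_2\in\mathbb{C}(\mathbf{i_1})\}$ be the commutative ring of bicomplex numbers ($\mathbf{i_1}^2=\mathbf{i_2}^2=-1$, $\mathbf{j}=\mathbf{i_1}\mathbf{i_2}$), with Euclidean norm $|w|=\sqrt{|z_1|^2+|z_2|^2}$, conjugation $w^{\dagger_3}=\bar z_1-\bar z_2\mathbf{i_2}$, idempotents $\mathbf{e_1}=\frac{1+\mathbf{j}}2$, $\mathbf{e_2}=\frac{1-\mathbf{j}}2$, and projections $P_1(w)=z_1-z_2\mathbf{i_1}$, $P_2(w)=z_1+z_2\mathbf{i_1}$, so that $w=\mathbf{e_1}P_1(w)+\mathbf{e_2}P_2(w)$. Let $\mathbb{D}^+=\{x_1\mathbf{e_1}+x_2\mathbf{e_2} : x_1,x_2\ge 0 \text{ real}\}$. A bicomplex scalar product on a $\mathbb{T}$-module $M$ is a map $(\cdot,\cdot):M\times M\to\mathbb{T}$ that is additive and $\mathbb{T}$-homogeneous in its second argument and satisfies $(\psi,\phi)=(\phi,\psi)^{\dagger_3}$, $(\psi,\psi)=0\Leftrightarrow\psi=0$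 and $(\psi,\psi)\in\mathbb{D}^+$. It induces $\|\phi\|=\frac1{\sqrt2}\sqrt{P_1\big((\mathbf{e_1}\phi,\mathbf{e_1}\phi)\big)+P_2\big((\mathbf{e_2}\phi,\mathbf{e_2}\phi)\big)}$. A bicomplex Hilbert space is a $\mathbb{T}$-module with a bicomplex scalar product that is complete for the metric $\|\phi-\psi\|$. A $\mathbb{T}$-norm is a norm on the underlying $\mathbb{C}(\mathbf{i_1})$-vector space with $\|w\psi\|\le\sqrt2\,|w|\,\|\psi\|$ for all $w\in\mathbb{T}$. A sequence $(m_l)_{l\ge0}$ in a $\mathbb{T}$-module with a $\mathbb{T}$-norm is a Schauder $\mathbb{T}$-basis if every $\psi$ has a unique expansion $\psi=\sum_{l=0}^\infty w_l m_l$, $w_l\in\mathbb{T}$, as a norm-convergent series. Let $M=\mathbf{e_1}L^2(\mathbb{R})\oplus\mathbf{e_2}L^2(\mathbb{R})$ be the $\mathbb{T}$-module of (almost-everywhere classes of) functions $u=\mathbf{e_1}u_{\hat1}+\mathbf{e_2}u_{\hat2}:\mathbb{R}\to\mathbb{T}$ with $u_{\hat1},u_{\hat2}\in L^2(\mathbb{R})$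 complex valued, and let $$(u,v)=\int_{-\infty}^{\infty}u^{\dagger_3}(x)\,v(x)\,dx .$$ 1. For all $u,v\in M$ the function $u^{\dagger_3}v$ is integrable, and $M$ with $(\cdot,\cdot)$ is a bicomplex Hilbert space. 2. Let $m,\omega,\hbar>0$ be real and let $\xi=\mathbf{e_1}\xi_{\hat1}+\mathbf{e_2}\xi_{\hat2}\in\mathbb{D}^+$ be invertible (i.e. $\xi_{\hat1},\xi_{\hat2}>0$). For $l\ge 0$ let $\phi_l=\mathbf{e_1}\phi_{l\hat1}+\mathbf{e_2}\phi_{l\hat2}$ be the bicomplex harmonic-oscillator functions, where $$\phi_{l\hat k}(x)=\left[\sqrt{\frac{m\omega}{\pi\hbar\xi_{\hat k}}}\,\frac1{2^l\,l!}\right]^{1/2}e^{-\theta_{\hat k}^2/2}H_l(\theta_{\hat k}),\qquad \theta_{\hat k}=\sqrt{\frac{m\omega}{\hbar\xi_{\hat k}}}\;x ,$$ and $H_l$ are the physicists' Hermite polynomials ($H_0=1$, $H_{l+1}=2XH_l-H_l'$). Then all $\phi_l$ belong to $M$, the induced norm on $M$ is a $\mathbb{T}$-norm, and every $u\in M$ can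 be expanded uniquely as $u=\sum_{l=0}^\infty w_l\phi_l$ with $w_l\in\mathbb{T}$, the series converging in the induced norm; that is, the $\phi_l$ form a Schauder $\mathbb{T}$-basis of $M$. -/

import Mathlib

open MeasureTheory Filter Topology

/-- The ring `𝕋` of bicomplex numbers `w = z₁ + z₂ i₂` with `z₁, z₂ ∈ ℂ(i₁)` and `i₂² = -1`;
`z₁ = w.re`, `z₂ = w.im`, and Mathlib's `ℂ` plays the role of `ℂ(i₁)`. -/
abbrev Bicomplex : Type := QuadraticAlgebra ℂ (-1) 0

namespace Bicomplex

noncomputable section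

/-- The unit `i₁`, i.e. `Complex.I` inside `𝕋`. -/
def i₁ : Bicomplex := ⟨Complex.I, 0⟩

/-- The unit `i₂`. -/
def i₂ : Bicomplex := ⟨0, 1⟩

/-- The hyperbolic unit `j = i₁ i₂`. -/
def j : Bicomplex := i₁ * i₂

/-- The idempotent `e₁ = (1 + j) / 2`. -/
def e₁ : Bicomplex := (1 / 2 : ℂ) • (1 + j)

/-- The idempotent `e₂ = (1 - j) / 2`. -/
def e₂ : Bicomplex := (1 / 2 : ℂ) • (1 - j)

/-- The first idempotent projection `z₁ + z₂ i₂ ↦ z₁ - z₂ i₁`. -/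
def P₁ (w : Bicomplex) : ℂ := w.re - w.im * Complex.I

/-- The second idempotent projection `z₁ + z₂ i₂ ↦ z₁ + z₂ i₁`. -/
def P₂ (w : Bicomplex) : ℂ := w.re + w.im * Complex.I

/-- The third conjugation `w^{†₃} = conj z₁ - (conj z₂) i₂`. -/
def conj₃ (w : Bicomplex) : Bicomplex :=
  ⟨(starRingEnd ℂ) w.re, -(starRingEnd ℂ) w.im⟩

/-- The set `𝔻⁺` of positive hyperbolic numbers `x₁ e₁ + x₂ e₂` with real `x₁, x₂ ≥ 0`. -/
def Dplus : Set Bicomplex :=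
  {w | ∃ x₁ x₂ : ℝ, 0 ≤ x₁ ∧ 0 ≤ x₂ ∧ w = (x₁ : ℂ) • e₁ + (x₂ : ℂ) • e₂}

/-- `(z₁, z₂)` as an element of the Hilbert sum `ℂ ⊕ ℂ`, used to define the Euclidean norm. -/
def toPair : Bicomplex →ₗ[ℂ] WithLp 2 (ℂ × ℂ) where
  toFun w := WithLp.toLp 2 (w.re, w.im)
  map_add' _ _ := rfl
  map_smul' _ _ := rfl

theorem toPair_injective : Function.Injective toPair := by
  intro v w h
  have h' := congrArg WithLp.ofLp h
  exact QuadraticAlgebra.ext (congrArg Prod.fst h') (congrArg Prod.snd h')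

/-- The Euclidean norm `|w| = √(|z₁|² + |z₂|²)` of `𝕋`. -/
instance : NormedAddCommGroup Bicomplex :=
  NormedAddCommGroup.induced Bicomplex (WithLp 2 (ℂ × ℂ)) toPair toPair_injective

theorem norm_eq (w : Bicomplex) : ‖w‖ = √(‖w.re‖ ^ 2 + ‖w.im‖ ^ 2) :=
  WithLp.prod_norm_eq_of_L2 (toPair w)

instance : NormedSpace ℂ Bicomplex :=
  NormedSpace.induced ℂ Bicomplex (WithLp 2 (ℂ × ℂ)) toPair

instance : NormedSpace ℝ Bicomplex :=
  NormedSpace.induced ℝ Bicomplex (WithLp 2 (ℂ × ℂ)) (toPair.restrictScalars ℝ)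

/-- Multiplication by a fixed bicomplex number is continuous, so that `𝕋` acts on classes of
`𝕋`-valued functions. -/
instance : ContinuousConstSMul Bicomplex Bicomplex where
  continuous_const_smul c := by
    let f : Bicomplex →ₗ[ℂ] Bicomplex := LinearMap.mulLeft ℂ c
    exact f.continuous_of_finiteDimensional

theorem re_one' : (1 : Bicomplex).re = 1 := rfl

theorem im_one' : (1 : Bicomplex).im = 0 := rfl

theorem P₁_idem (z w : ℂ) : P₁ (z • e₁ + w • e₂) = z := by
  simp [P₁, e₁, e₂, j, i₁, i₂, re_one', im_one']
  linear_combination (w / 2 - z / 2) * Complex.I_sq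

theorem P₂_idem (z w : ℂ) : P₂ (z • e₁ + w • e₂) = w := by
  simp [P₂, e₁, e₂, j, i₁, i₂, re_one', im_one']
  linear_combination (z / 2 - w / 2) * Complex.I_sq

theorem idem_decomp (w : Bicomplex) : P₁ w • e₁ + P₂ w • e₂ = w := by
  ext
  · simp [P₁, P₂, e₁, e₂, j, i₁, i₂, re_one']
    ring
  · simp [P₁, P₂, e₁, e₂, j, i₁, i₂, im_one']
    linear_combination (-w.im) * Complex.I_sq

theorem mul_idem (c : Bicomplex) (z w : ℂ) :
    c * (z • e₁ + w • e₂) = (P₁ c * z) • e₁ + (P₂ c * w) • e₂ := by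
  ext
  · simp [P₁, P₂, e₁, e₂, j, i₁, i₂, re_one', im_one']
    ring
  · simp [P₁, P₂, e₁, e₂, j, i₁, i₂, re_one', im_one']
    linear_combination ((z + w) / 2 * c.im) * Complex.I_sq

/-! ### Bicomplex scalar products and bicomplex Hilbert spaces -/

section Abstract

variable {M : Type*} [AddCommGroup M] [Module Bicomplex M]

/-- A (hyperbolic positive) bicomplex scalar product on a `𝕋`-module, linear in the second
argument. -/
structure IsScalarProduct (ip : M → M → Bicomplex) : Prop where
  add_right : ∀ ψ φ χ, ip ψ (φ + χ) = ip ψ φ + ip ψ χ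
  smul_right : ∀ (α : Bicomplex) (ψ φ), ip ψ (α • φ) = α * ip ψ φ
  conj_symm : ∀ ψ φ, ip ψ φ = conj₃ (ip φ ψ)
  definite : ∀ ψ, ip ψ ψ = 0 ↔ ψ = 0
  hyperbolic_pos : ∀ ψ, ip ψ ψ ∈ Dplus

/-- A `𝕋`-norm on a `𝕋`-module: a norm on the underlying complex vector space such that
`‖w ψ‖ ≤ √2 |w| ‖ψ‖` for all bicomplex `w`. -/
structure IsTNorm (nrm : M → ℝ) : Prop where
  nonneg : ∀ ψ, 0 ≤ nrm ψ
  eq_zero_iff : ∀ ψ, nrm ψ = 0 ↔ ψ = 0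
  add_le : ∀ ψ φ, nrm (ψ + φ) ≤ nrm ψ + nrm φ
  complex_smul : ∀ (z : ℂ) (ψ), nrm (algebraMap ℂ Bicomplex z • ψ) = ‖z‖ * nrm ψ
  smul_le : ∀ (w : Bicomplex) (ψ), nrm (w • ψ) ≤ √2 * ‖w‖ * nrm ψ

/-- The norm induced by a bicomplex scalar product,
`‖φ‖ = (1/√2) √( P₁(e₁φ, e₁φ) + P₂(e₂φ, e₂φ) )`. -/
def inducedNorm (ip : M → M → Bicomplex) (φ : M) : ℝ :=
  1 / √2 * √((P₁ (ip (e₁ • φ) (e₁ • φ))).re + (P₂ (ip (e₂ • φ) (e₂ • φ))).re)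

/-- A bicomplex Hilbert space: a `𝕋`-module with a bicomplex scalar product, complete for the
metric `d(φ, ψ) = ‖φ - ψ‖` of the induced norm. -/
structure IsHilbert (ip : M → M → Bicomplex) : Prop where
  scalarProduct : IsScalarProduct ip
  complete : ∀ u : ℕ → M,
    (∀ ε > 0, ∃ N, ∀ m ≥ N, ∀ n ≥ N, inducedNorm ip (u m - u n) < ε) →
      ∃ ψ : M, Tendsto (fun n => inducedNorm ip (u n - ψ)) atTop (𝓝 0)

/-- `ψ = ∑_{l=0}^∞ w_l m_l`, the partial sums converging to `ψ` in the norm `nrm`. -/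
def HasExpansion (nrm : M → ℝ) (m : ℕ → M) (w : ℕ → Bicomplex) (ψ : M) : Prop :=
  Tendsto (fun N => nrm (ψ - ∑ l ∈ Finset.range N, w l • m l)) atTop (𝓝 0)

/-- The sequence `m` is a Schauder `𝕋`-basis of the normed `𝕋`-module `(M, nrm)`. -/
structure IsSchauderBasis (nrm : M → ℝ) (m : ℕ → M) : Prop where
  isTNorm : IsTNorm nrm
  existsUnique : ∀ ψ : M, ∃! w : ℕ → Bicomplex, HasExpansion nrm m w ψ

end Abstract

/-! ### The bicomplex module `e₁ L²(ℝ) ⊕ e₂ L²(ℝ)` -/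

/-- The `𝕋`-module `M = e₁ L²(ℝ) ⊕ e₂ L²(ℝ)` of (classes of) bicomplex functions
`u = e₁ u₁ + e₂ u₂` of a real variable with `u₁, u₂ ∈ L²(ℝ)`. -/
def L2Module : Submodule Bicomplex (ℝ →ₘ[volume] Bicomplex) where
  carrier := {u | ∃ u₁ u₂ : Lp ℂ 2 (volume : Measure ℝ),
    u =ᵐ[volume] fun x => u₁ x • e₁ + u₂ x • e₂}
  zero_mem' := by
    refine ⟨0, 0, ?_⟩
    filter_upwards [AEEqFun.coeFn_zero (α := ℝ) (β := Bicomplex) (μ := volume),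
      Lp.coeFn_zero ℂ 2 (volume : Measure ℝ)] with x h₁ h₂
    rw [h₁, h₂]
    simp
  add_mem' := by
    rintro u v ⟨u₁, u₂, hu⟩ ⟨v₁, v₂, hv⟩
    refine ⟨u₁ + v₁, u₂ + v₂, ?_⟩
    filter_upwards [hu, hv, AEEqFun.coeFn_add u v, Lp.coeFn_add u₁ v₁, Lp.coeFn_add u₂ v₂]
      with x h₁ h₂ h₃ h₄ h₅
    rw [h₃, h₄, h₅, Pi.add_apply, h₁, h₂, Pi.add_apply, Pi.add_apply, add_smul, add_smul]
    abel
  smul_mem' := by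
    rintro c u ⟨u₁, u₂, hu⟩
    refine ⟨P₁ c • u₁, P₂ c • u₂, ?_⟩
    filter_upwards [hu, AEEqFun.coeFn_smul c u, Lp.coeFn_smul (P₁ c) u₁,
      Lp.coeFn_smul (P₂ c) u₂] with x h₁ h₂ h₃ h₄
    rw [h₂, h₃, h₄, Pi.smul_apply, h₁]
    exact mul_idem c _ _

/-- The integral scalar product `(u, v) = ∫ u^{†₃}(x) v(x) dx`. -/
def integralProduct (u v : L2Module) : Bicomplex :=
  ∫ x : ℝ, conj₃ ((u : ℝ →ₘ[volume] Bicomplex) x) * (v : ℝ →ₘ[volume] Bicomplex) x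

/-! ### Harmonic oscillator eigenfunctions -/

/-- The (physicists') Hermite polynomials: `H₀ = 1`, `H_{l+1} = 2 X H_l - H_l'`. -/
def hermiteH : ℕ → Polynomial ℝ
  | 0 => 1
  | l + 1 => 2 * Polynomial.X * hermiteH l - Polynomial.derivative (hermiteH l)

/-- The normalized eigenfunction of level `l` of the standard harmonic oscillator with mass `m`,
frequency `ω` and with `ħ ξ` in place of `ħ`:
`[√(mω/(πħξ)) / (2^l l!)]^{1/2} exp(-θ²/2) H_l(θ)` with `θ = √(mω/(ħξ)) x`. -/
def oscillator (m ω ħ ξ : ℝ) (l : ℕ) (x : ℝ) : ℝ :=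
  √(√(m * ω / (Real.pi * ħ * ξ)) * (1 / (2 ^ l * (l.factorial : ℝ)))) *
    Real.exp (-(√(m * ω / (ħ * ξ)) * x) ^ 2 / 2) *
    (hermiteH l).eval (√(m * ω / (ħ * ξ)) * x)

/-- The bicomplex harmonic oscillator eigenfunction `φ_l = e₁ φ_{l,1} + e₂ φ_{l,2}` for the
hyperbolic parameter `ξ = e₁ ξ₁ + e₂ ξ₂`. -/
def bicomplexOscillator (m ω ħ : ℝ) (ξ : Bicomplex) (l : ℕ) (x : ℝ) : Bicomplex :=
  (oscillator m ω ħ (P₁ ξ).re l x : ℂ) • e₁ + (oscillator m ω ħ (P₂ ξ).re l x : ℂ) • e₂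

end

end Bicomplex

namespace Bicomplex

noncomputable section

/-! In idempotent coordinates `P₁`, `P₂` the ring 𝕋 is ℂ × ℂ with componentwise operations, and
`conj₃` is complex conjugation in each coordinate. Through `comp`, the module is therefore the
Hilbert sum of two copies of L²(ℝ), on which 𝕋 acts diagonally. The scalar product is the pair of L²
inner products (`integralProduct_eq`) and the induced norm is 1/√2 times the Hilbert-sum norm
(`inducedNorm_eq`), so completeness and the norm axioms are inherited. A bicomplex expansion is a
pair of complex ones (`hasExpansion_iff`).

It remains that the Hermite functions of any scale c > 0 form a Hilbert basis of L²(ℝ).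
Orthonormality is integration by parts against the Gaussian (`integral_hermiteH_mul_hermiteH`). For
completeness, a function r orthogonal to all of them makes every moment of g = exp(-(cx)²/2) r
vanish. Since g has all exponential moments, g⁺dx and g⁻dx are determined by their moments and so
coincide (`ae_eq_zero_of_moments_eq_zero`), whence r = 0. -/

/-! ### Algebra of the idempotent projections -/

theorem P₁_add (v w : Bicomplex) : P₁ (v + w) = P₁ v + P₁ w := by
  simp [P₁]; ring

theorem P₂_add (v w : Bicomplex) : P₂ (v + w) = P₂ v + P₂ w := by
  simp [P₂]; ring

theorem P₁_conj₃ (w : Bicomplex) : P₁ (conj₃ w) = (starRingEnd ℂ) (P₁ w) := by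
  simp [P₁, conj₃]

theorem P₂_conj₃ (w : Bicomplex) : P₂ (conj₃ w) = (starRingEnd ℂ) (P₂ w) := by
  simp [P₂, conj₃]

theorem ext_P {v w : Bicomplex} (h₁ : P₁ v = P₁ w) (h₂ : P₂ v = P₂ w) : v = w := by
  rw [← idem_decomp v, ← idem_decomp w, h₁, h₂]

theorem P₁_mul (v w : Bicomplex) : P₁ (v * w) = P₁ v * P₁ w := by
  conv_lhs => rw [← idem_decomp w, mul_idem, P₁_idem]

theorem P₂_mul (v w : Bicomplex) : P₂ (v * w) = P₂ v * P₂ w := by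
  conv_lhs => rw [← idem_decomp w, mul_idem, P₂_idem]

theorem P₁_e₁ : P₁ e₁ = 1 := by simpa using P₁_idem 1 0

theorem P₂_e₂ : P₂ e₂ = 1 := by simpa using P₂_idem 0 1

theorem P₁_one : P₁ 1 = 1 := by simp [P₁, re_one', im_one']

theorem P₂_one : P₂ 1 = 1 := by simp [P₂, re_one', im_one']

theorem P₁_algebraMap (z : ℂ) : P₁ (algebraMap ℂ Bicomplex z) = z := by
  simp [P₁]

theorem P₂_algebraMap (z : ℂ) : P₂ (algebraMap ℂ Bicomplex z) = z := by
  simp [P₂]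

/-- The two idempotent projections control the Euclidean norm through the parallelogram law. -/
theorem norm_sq_P₁_add_norm_sq_P₂ (w : Bicomplex) :
    ‖P₁ w‖ ^ 2 + ‖P₂ w‖ ^ 2 = 2 * ‖w‖ ^ 2 := by
  rw [norm_eq, Real.sq_sqrt (by positivity)]
  have h := parallelogram_law_with_norm ℂ w.re (w.im * Complex.I)
  rw [norm_mul, Complex.norm_I, mul_one] at h
  simp only [P₁, P₂]
  linarith

instance : CompleteSpace Bicomplex := FiniteDimensional.complete ℂ Bicomplex

/-! ### The components of an element of `L2Module` -/

/-- The Hilbert sum `L²(ℝ) ⊕ L²(ℝ)`. -/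
abbrev L2Pair : Type := WithLp 2 (Lp ℂ 2 (volume : Measure ℝ) × Lp ℂ 2 (volume : Measure ℝ))

/-- The pair of components of an element of `L2Module`. -/
def comp (u : L2Module) : L2Pair :=
  WithLp.toLp 2 (u.2.choose, u.2.choose_spec.choose)

theorem coeFn_eq_comp (u : L2Module) : (u : ℝ →ₘ[volume] Bicomplex) =ᵐ[volume]
    fun x => (comp u).fst x • e₁ + (comp u).snd x • e₂ :=
  u.2.choose_spec.choose_spec

/-- The choice made in `comp` is immaterial, because `P₁` and `P₂` recover the coefficients
pointwise. -/
theorem comp_eq {u : L2Module} {p : L2Pair} (h : (u : ℝ →ₘ[volume] Bicomplex) =ᵐ[volume]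
    fun x => p.fst x • e₁ + p.snd x • e₂) : comp u = p := by
  have h₁ : (comp u).fst = p.fst := by
    refine Lp.ext ?_
    filter_upwards [h, coeFn_eq_comp u] with x hx hx'
    rw [← P₁_idem ((comp u).fst x) ((comp u).snd x), ← hx', hx, P₁_idem]
  have h₂ : (comp u).snd = p.snd := by
    refine Lp.ext ?_
    filter_upwards [h, coeFn_eq_comp u] with x hx hx'
    rw [← P₂_idem ((comp u).fst x) ((comp u).snd x), ← hx', hx, P₂_idem]
  exact WithLp.ofLp_injective 2 (Prod.ext h₁ h₂)

theorem exists_comp_eq (p : L2Pair) : ∃ u : L2Module, comp u = p := by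
  have hm : AEStronglyMeasurable (fun x => p.fst x • e₁ + p.snd x • e₂) volume :=
    ((Lp.aestronglyMeasurable p.fst).smul_const e₁).add
      ((Lp.aestronglyMeasurable p.snd).smul_const e₂)
  exact ⟨⟨AEEqFun.mk _ hm, p.fst, p.snd, AEEqFun.coeFn_mk _ hm⟩,
    comp_eq (AEEqFun.coeFn_mk _ hm)⟩

theorem comp_injective : Function.Injective comp := by
  intro u v h
  refine Subtype.ext (AEEqFun.ext ?_)
  have hu := coeFn_eq_comp u
  rw [h] at hu
  exact hu.trans (coeFn_eq_comp v).symm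

theorem comp_add (u v : L2Module) : comp (u + v) = comp u + comp v := by
  refine comp_eq ?_
  filter_upwards [coeFn_eq_comp u, coeFn_eq_comp v,
    AEEqFun.coeFn_add (u : ℝ →ₘ[volume] Bicomplex) v,
    Lp.coeFn_add (comp u).fst (comp v).fst, Lp.coeFn_add (comp u).snd (comp v).snd]
    with x h₁ h₂ h₃ h₄ h₅
  rw [Submodule.coe_add, h₃, Pi.add_apply, h₁, h₂, WithLp.add_fst, WithLp.add_snd, h₄, h₅,
    Pi.add_apply, Pi.add_apply, add_smul, add_smul]
  abel

theorem comp_smul (c : Bicomplex) (u : L2Module) :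
    comp (c • u) = WithLp.toLp 2 (P₁ c • (comp u).fst, P₂ c • (comp u).snd) := by
  refine comp_eq ?_
  filter_upwards [coeFn_eq_comp u, AEEqFun.coeFn_smul c (u : ℝ →ₘ[volume] Bicomplex),
    Lp.coeFn_smul (P₁ c) (comp u).fst, Lp.coeFn_smul (P₂ c) (comp u).snd] with x h₁ h₂ h₃ h₄
  rw [Submodule.coe_smul, h₂, Pi.smul_apply, h₁]
  change _ = (P₁ c • (comp u).fst : Lp ℂ 2 volume) x • e₁ +
    (P₂ c • (comp u).snd : Lp ℂ 2 volume) x • e₂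
  rw [h₃, h₄]
  exact mul_idem c _ _

/-- `comp` as an additive map. -/
def compHom : L2Module →+ L2Pair := AddMonoidHom.mk' comp comp_add

theorem comp_sub (u v : L2Module) : comp (u - v) = comp u - comp v := map_sub compHom u v

theorem comp_zero : comp 0 = 0 := map_zero compHom

theorem comp_sum_smul (s : Finset ℕ) (w : ℕ → Bicomplex) (φ : ℕ → L2Module) :
    comp (∑ l ∈ s, w l • φ l) = WithLp.toLp 2
      (∑ l ∈ s, P₁ (w l) • (comp (φ l)).fst, ∑ l ∈ s, P₂ (w l) • (comp (φ l)).snd) := by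
  induction s using Finset.cons_induction with
  | empty => exact comp_zero
  | cons a s ha ih => rw [Finset.sum_cons, comp_add, ih, comp_smul, Finset.sum_cons,
      Finset.sum_cons, ← WithLp.toLp_add, Prod.mk_add_mk]

/-! ### The scalar product -/

theorem integrand_ae_eq (u v : L2Module) :
    (fun x : ℝ => conj₃ ((u : ℝ →ₘ[volume] Bicomplex) x) * (v : ℝ →ₘ[volume] Bicomplex) x)
      =ᵐ[volume] fun x => inner ℂ ((comp u).fst x) ((comp v).fst x) • e₁ +
        inner ℂ ((comp u).snd x) ((comp v).snd x) • e₂ := by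
  filter_upwards [coeFn_eq_comp u, coeFn_eq_comp v] with x h₁ h₂
  rw [h₁, h₂, mul_idem, P₁_conj₃, P₂_conj₃, P₁_idem, P₂_idem, RCLike.inner_apply',
    RCLike.inner_apply']

theorem integrable_integrand (u v : L2Module) : Integrable (fun x : ℝ =>
    conj₃ ((u : ℝ →ₘ[volume] Bicomplex) x) * (v : ℝ →ₘ[volume] Bicomplex) x) :=
  (((L2.integrable_inner _ _).smul_const e₁).add
    ((L2.integrable_inner _ _).smul_const e₂)).congr (integrand_ae_eq u v).symm

theorem integralProduct_eq (u v : L2Module) : integralProduct u v =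
    inner ℂ (comp u).fst (comp v).fst • e₁ + inner ℂ (comp u).snd (comp v).snd • e₂ := by
  rw [integralProduct, integral_congr_ae (integrand_ae_eq u v),
    integral_add ((L2.integrable_inner _ _).smul_const e₁)
      ((L2.integrable_inner _ _).smul_const e₂), integral_smul_const, integral_smul_const,
    L2.inner_def, L2.inner_def]

theorem P₁_integralProduct (u v : L2Module) :
    P₁ (integralProduct u v) = inner ℂ (comp u).fst (comp v).fst := by
  rw [integralProduct_eq, P₁_idem]

theorem P₂_integralProduct (u v : L2Module) :
    P₂ (integralProduct u v) = inner ℂ (comp u).snd (comp v).snd := by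
  rw [integralProduct_eq, P₂_idem]

/-- As `P₁ e₁ = P₂ e₂ = 1`, the two terms under the root are the squared L² norms of the components.
-/
theorem inducedNorm_eq (u : L2Module) : inducedNorm integralProduct u = 1 / √2 * ‖comp u‖ := by
  rw [inducedNorm, P₁_integralProduct, P₂_integralProduct, comp_smul, comp_smul,
    WithLp.prod_norm_eq_of_L2]
  simp [P₁_e₁, P₂_e₂, inner_self_eq_norm_sq_to_K, ← Complex.ofReal_pow]

theorem isScalarProduct_integralProduct : IsScalarProduct integralProduct where
  add_right ψ φ χ := by
    refine ext_P ?_ ?_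
    · simp [P₁_add, P₁_integralProduct, comp_add, inner_add_right]
    · simp [P₂_add, P₂_integralProduct, comp_add, inner_add_right]
  smul_right α ψ φ := by
    refine ext_P ?_ ?_
    · simp [P₁_mul, P₁_integralProduct, comp_smul, inner_smul_right]
    · simp [P₂_mul, P₂_integralProduct, comp_smul, inner_smul_right]
  conj_symm ψ φ := by
    refine ext_P ?_ ?_
    · rw [P₁_conj₃, P₁_integralProduct, P₁_integralProduct, inner_conj_symm]
    · rw [P₂_conj₃, P₂_integralProduct, P₂_integralProduct, inner_conj_symm]
  definite ψ := by
    constructor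
    · intro h
      have h₁ := P₁_integralProduct ψ ψ
      have h₂ := P₂_integralProduct ψ ψ
      rw [h] at h₁ h₂
      refine comp_injective (WithLp.ofLp_injective 2 (Prod.ext ?_ ?_))
      · rw [comp_zero]
        exact inner_self_eq_zero.1 (h₁.symm.trans (by simp [P₁]))
      · rw [comp_zero]
        exact inner_self_eq_zero.1 (h₂.symm.trans (by simp [P₂]))
    · rintro rfl
      rw [integralProduct_eq, comp_zero]
      simp
  hyperbolic_pos ψ := by
    refine ⟨‖(comp ψ).fst‖ ^ 2, ‖(comp ψ).snd‖ ^ 2, by positivity, by positivity, ?_⟩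
    rw [integralProduct_eq, inner_self_eq_norm_sq_to_K, inner_self_eq_norm_sq_to_K]
    simp

/-! ### Completeness and the 𝕋-norm -/

theorem tendsto_inducedNorm_iff {ι : Type*} {l : Filter ι} {u : ι → L2Module} :
    Tendsto (fun n => inducedNorm integralProduct (u n)) l (𝓝 0) ↔
      Tendsto (fun n => comp (u n)) l (𝓝 0) := by
  simp only [inducedNorm_eq]
  rw [tendsto_zero_iff_norm_tendsto_zero (f := fun n => comp (u n))]
  constructor
  · intro h
    have := h.const_mul √2
    simpa [← mul_assoc] using this
  · intro h
    simpa using h.const_mul (1 / √2)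

theorem isHilbert_integralProduct : IsHilbert integralProduct where
  scalarProduct := isScalarProduct_integralProduct
  complete u hu := by
    have hc : CauchySeq fun n => comp (u n) := by
      rw [Metric.cauchySeq_iff]
      intro ε hε
      obtain ⟨N, hN⟩ := hu (1 / √2 * ε) (by positivity)
      refine ⟨N, fun m hm n hn => ?_⟩
      have := hN m hm n hn
      rw [inducedNorm_eq, comp_sub] at this
      rw [dist_eq_norm]
      exact lt_of_mul_lt_mul_left this (by positivity)
    obtain ⟨p, hp⟩ := cauchySeq_tendsto_of_complete hc
    obtain ⟨ψ, rfl⟩ := exists_comp_eq p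
    refine ⟨ψ, tendsto_inducedNorm_iff.2 ?_⟩
    simp only [comp_sub]
    exact tendsto_sub_nhds_zero_iff.2 hp

/-- The constant √2 comes from |P₁ w|² + |P₂ w|² = 2|w|²; expanding the product on the right only
adds nonnegative cross terms. -/
theorem norm_comp_smul_le (w : Bicomplex) (ψ : L2Module) :
    ‖comp (w • ψ)‖ ≤ √2 * ‖w‖ * ‖comp ψ‖ := by
  have hw := norm_sq_P₁_add_norm_sq_P₂ w
  refine le_of_sq_le_sq ?_ (by positivity)
  rw [mul_pow, mul_pow, Real.sq_sqrt zero_le_two, comp_smul, WithLp.prod_norm_sq_eq_of_L2,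
    WithLp.prod_norm_sq_eq_of_L2, ← hw]
  simp only [WithLp.toLp_fst, WithLp.toLp_snd, norm_smul, mul_pow]
  nlinarith [mul_nonneg (sq_nonneg ‖P₁ w‖) (sq_nonneg ‖(comp ψ).snd‖),
    mul_nonneg (sq_nonneg ‖P₂ w‖) (sq_nonneg ‖(comp ψ).fst‖)]

theorem isTNorm_inducedNorm : IsTNorm (inducedNorm integralProduct) where
  nonneg ψ := by rw [inducedNorm_eq]; positivity
  eq_zero_iff ψ := by
    rw [inducedNorm_eq, mul_eq_zero, norm_eq_zero]
    constructor
    · rintro (h | h)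
      · simp at h
      · exact comp_injective (h.trans comp_zero.symm)
    · rintro rfl
      exact .inr comp_zero
  add_le ψ φ := by
    simp only [inducedNorm_eq, comp_add, ← mul_add]
    gcongr
    exact norm_add_le _ _
  complex_smul z ψ := by
    have : comp (algebraMap ℂ Bicomplex z • ψ) = z • comp ψ := by
      rw [comp_smul, P₁_algebraMap, P₂_algebraMap]
      rfl
    rw [inducedNorm_eq, inducedNorm_eq, this, norm_smul]
    ring
  smul_le w ψ := by
    rw [inducedNorm_eq, inducedNorm_eq, mul_left_comm]
    gcongr
    exact norm_comp_smul_le w ψ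

/-! ### Schauder bases from pairs of Schauder bases -/

/-- The partial sums of `∑ aₗ hₗ` converge to `f`. -/
def IsExpansion (h : ℕ → Lp ℂ 2 (volume : Measure ℝ)) (a : ℕ → ℂ)
    (f : Lp ℂ 2 (volume : Measure ℝ)) : Prop :=
  Tendsto (fun N => ∑ l ∈ Finset.range N, a l • h l) atTop (𝓝 f)

/-- The Hilbert sum carries the product topology, so partial sums converge exactly when both
components do. -/
theorem hasExpansion_iff {φ : ℕ → L2Module} {w : ℕ → Bicomplex} {ψ : L2Module} :
    HasExpansion (inducedNorm integralProduct) φ w ψ ↔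
      IsExpansion (fun l => (comp (φ l)).fst) (fun l => P₁ (w l)) (comp ψ).fst ∧
      IsExpansion (fun l => (comp (φ l)).snd) (fun l => P₂ (w l)) (comp ψ).snd := by
  have h0 : Tendsto (fun N => comp ψ - comp (∑ l ∈ Finset.range N, w l • φ l)) atTop (𝓝 0) ↔
      Tendsto (fun N => comp (∑ l ∈ Finset.range N, w l • φ l)) atTop (𝓝 (comp ψ)) := by
    refine ⟨fun h => ?_, fun h => ?_⟩
    · simpa only [sub_sub_cancel, sub_zero] using h.const_sub (comp ψ)
    · simpa only [sub_self] using h.const_sub (comp ψ)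
  rw [HasExpansion, tendsto_inducedNorm_iff]
  simp only [comp_sub]
  rw [h0]
  simp only [comp_sum_smul, IsExpansion]
  rw [← Prod.tendsto_iff (fun N => (∑ l ∈ Finset.range N, P₁ (w l) • (comp (φ l)).fst,
    ∑ l ∈ Finset.range N, P₂ (w l) • (comp (φ l)).snd)) ((comp ψ).fst, (comp ψ).snd)]
  exact ⟨fun h => ((WithLp.prod_continuous_ofLp 2 _ _).tendsto _).comp h,
    fun h => ((WithLp.prod_continuous_toLp 2 _ _).tendsto _).comp h⟩

theorem isSchauderBasis_of_components {φ : ℕ → L2Module}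
    (h₁ : ∀ f, ∃! a, IsExpansion (fun l => (comp (φ l)).fst) a f)
    (h₂ : ∀ f, ∃! a, IsExpansion (fun l => (comp (φ l)).snd) a f) :
    IsSchauderBasis (inducedNorm integralProduct) φ where
  isTNorm := isTNorm_inducedNorm
  existsUnique ψ := by
    obtain ⟨a, ha, ha'⟩ := h₁ (comp ψ).fst
    obtain ⟨b, hb, hb'⟩ := h₂ (comp ψ).snd
    refine ⟨fun l => a l • e₁ + b l • e₂, hasExpansion_iff.2 ?_, fun w hw => ?_⟩
    · simp only [P₁_idem, P₂_idem]
      exact ⟨ha, hb⟩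
    · obtain ⟨hw₁, hw₂⟩ := hasExpansion_iff.1 hw
      funext l
      rw [← ha' _ hw₁, ← hb' _ hw₂, idem_decomp]

/-! ### A function with exponential moments is determined by its moments -/

section Moments

open ProbabilityTheory

/-- Integrability of `exp (t x) g(x)` passes to the measure with density `g⁺`. -/
theorem integrable_exp_withDensity_ofReal {g : ℝ → ℝ}
    (hg : ∀ t : ℝ, Integrable (fun x => Real.exp (t * x) * g x)) (t : ℝ) :
    Integrable (fun x => Real.exp (t * id x))
      (volume.withDensity fun x => ENNReal.ofReal (g x)) := by
  have hm : AEMeasurable g := by simpa using (hg 0).aemeasurable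
  rw [integrable_withDensity_iff_integrable_smul₀' hm.ennreal_ofReal (by simp)]
  -- Since exp > 0, the positive part of exp(tx) g is exp(tx) g⁺.
  refine (hg t).pos_part.congr (.of_forall fun x => ?_)
  simp only [ENNReal.toReal_ofReal', smul_eq_mul, id]
  rw [mul_comm (max _ _), mul_max_of_nonneg _ _ (Real.exp_pos _).le, mul_zero]

theorem integrableExpSet_withDensity_ofReal {g : ℝ → ℝ}
    (hg : ∀ t : ℝ, Integrable (fun x => Real.exp (t * x) * g x)) :
    integrableExpSet id (volume.withDensity fun x => ENNReal.ofReal (g x)) = Set.univ :=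
  Set.eq_univ_of_forall fun t => integrable_exp_withDensity_ofReal hg t

theorem integrable_pow_mul_max {g : ℝ → ℝ}
    (hg : ∀ t : ℝ, Integrable (fun x => Real.exp (t * x) * g x)) (n : ℕ) :
    Integrable (fun x => max (g x) 0 * x ^ n) := by
  have hm : AEMeasurable g := by simpa using (hg 0).aemeasurable
  have h : Integrable (fun x : ℝ => id x ^ n)
      (volume.withDensity fun x => ENNReal.ofReal (g x)) :=
    integrable_pow_of_mem_interior_integrableExpSet
      (by simp [integrableExpSet_withDensity_ofReal hg]) n
  rw [integrable_withDensity_iff_integrable_smul₀' hm.ennreal_ofReal (by simp)] at h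
  simpa [ENNReal.toReal_ofReal'] using h

theorem integral_pow_withDensity_ofReal {g : ℝ → ℝ} (hm : AEMeasurable g) (n : ℕ) :
    ∫ x, x ^ n ∂(volume.withDensity fun x => ENNReal.ofReal (g x)) =
      ∫ x, max (g x) 0 * x ^ n := by
  rw [integral_withDensity_eq_integral_toReal_smul₀ hm.ennreal_ofReal (by simp)]
  simp [ENNReal.toReal_ofReal']

/-- The moments are, up to factorials, the Taylor coefficients at 0 of the moment generating
function. This function is analytic on all of ℝ, so the two agree everywhere; the agreement extends
to the complex one, which determines the measure. -/
theorem measure_eq_of_moments_eq {μ ν : Measure ℝ} [IsFiniteMeasure μ] [IsFiniteMeasure ν]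
    (hμ : integrableExpSet id μ = Set.univ) (hν : integrableExpSet id ν = Set.univ)
    (h : ∀ n : ℕ, ∫ x, x ^ n ∂μ = ∫ x, x ^ n ∂ν) : μ = ν := by
  have h1 := hasFPowerSeriesAt_mgf (X := id) (μ := μ) (v := 0) (by simp [hμ])
  have h2 := hasFPowerSeriesAt_mgf (X := id) (μ := ν) (v := 0) (by simp [hν])
  simp only [id, zero_mul, Real.exp_zero, mul_one, h] at h1 h2
  have he : mgf id μ =ᶠ[𝓝 0] mgf id ν := by
    filter_upwards [h1.eventually_hasSum, h2.eventually_hasSum] with y hy₁ hy₂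
    simpa using hy₁.unique hy₂
  have hA : AnalyticOnNhd ℝ (mgf id μ) Set.univ := by
    simpa [hμ] using analyticOnNhd_mgf (X := id) (μ := μ)
  have hB : AnalyticOnNhd ℝ (mgf id ν) Set.univ := by
    simpa [hν] using analyticOnNhd_mgf (X := id) (μ := ν)
  have hmgf : mgf id μ = mgf id ν := hA.eq_of_eventuallyEq hB he
  -- The zeroth moment is the total mass; this settles the degenerate case in
  -- `eqOn_complexMGF_of_mgf'`.
  have hz : μ = 0 ↔ ν = 0 := by
    have := h 0
    simp only [pow_zero, integral_const, smul_eq_mul, mul_one] at this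
    rw [← Measure.measure_univ_eq_zero, ← Measure.measure_univ_eq_zero,
      ← measureReal_eq_zero_iff, ← measureReal_eq_zero_iff, this]
  refine Measure.ext_of_complexMGF_id_eq (funext fun z => ?_)
  exact eqOn_complexMGF_of_mgf' hmgf hz (by simp [hμ])

/-- The finite measures g⁺dx and g⁻dx have equal moments, hence are equal; then g⁺ = g⁻ a.e., which
forces both to vanish. -/
theorem ae_eq_zero_of_moments_eq_zero {g : ℝ → ℝ}
    (hg : ∀ t : ℝ, Integrable (fun x => Real.exp (t * x) * g x))
    (h : ∀ n : ℕ, ∫ x, x ^ n * g x = 0) : g =ᵐ[volume] 0 := by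
  have hi : Integrable g := by simpa using hg 0
  have hg' : ∀ t : ℝ, Integrable (fun x => Real.exp (t * x) * (-g) x) := fun t => by
    simpa using (hg t).neg
  have hf {f : ℝ → ℝ} (hf : Integrable f) : ∫⁻ x, ENNReal.ofReal (f x) ≠ ⊤ := by
    have := hf.2
    exact ((lintegral_mono fun x => Real.ofReal_le_enorm (f x)).trans_lt this).ne
  have := isFiniteMeasure_withDensity (hf hi)
  have := isFiniteMeasure_withDensity (hf hi.neg)
  have hμν := measure_eq_of_moments_eq (integrableExpSet_withDensity_ofReal hg)
    (integrableExpSet_withDensity_ofReal hg') fun n => by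
      rw [integral_pow_withDensity_ofReal hi.aemeasurable,
        integral_pow_withDensity_ofReal hi.neg.aemeasurable, ← sub_eq_zero,
        ← integral_sub (integrable_pow_mul_max hg n) (integrable_pow_mul_max hg' n)]
      refine Eq.trans ?_ (h n)
      congr 1 with x
      have : max (g x) 0 - max ((-g) x) 0 = g x := by
        rcases le_total 0 (g x) with hx | hx <;> simp [hx]
      rw [← sub_mul, this, mul_comm]
  rw [withDensity_eq_iff hi.aemeasurable.ennreal_ofReal hi.neg.aemeasurable.ennreal_ofReal
    (hf hi)] at hμν
  filter_upwards [hμν] with x hx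
  rcases le_total 0 (g x) with h0 | h0
  · rw [Pi.neg_apply, ENNReal.ofReal_of_nonpos (neg_nonpos.2 h0), ENNReal.ofReal_eq_zero] at hx
    exact le_antisymm hx h0
  · rw [ENNReal.ofReal_of_nonpos h0, eq_comm, Pi.neg_apply, ENNReal.ofReal_eq_zero] at hx
    exact le_antisymm h0 (neg_nonpos.1 hx)

end Moments

/-! ### Hermite polynomials -/

section Hermite

open Polynomial

theorem derivative_hermiteH_succ (l : ℕ) :
    derivative (hermiteH (l + 1)) = (2 * (l + 1 : ℝ)) • hermiteH l := by
  induction l with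
  | zero =>
    simp [hermiteH, smul_eq_C_mul]
    rfl
  | succ l ih =>
    rw [hermiteH, derivative_sub, ih, derivative_mul, ih, derivative_smul]
    have : hermiteH (l + 1) = 2 * X * hermiteH l - derivative (hermiteH l) := rfl
    simp only [smul_eq_C_mul, derivative_mul, derivative_X, derivative_ofNat, map_mul, map_add,
      map_natCast, map_ofNat, map_one, Nat.cast_add, Nat.cast_one]
    linear_combination (-2 * ((l : ℝ[X]) + 1)) * this

/-- Every polynomial is a combination of Hermite polynomials. -/
theorem span_hermiteH : Submodule.span ℝ (Set.range hermiteH) = ⊤ := by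
  -- A span containing 1 and stable under multiplication by X contains all monomials. Stability is
  -- the recursion read backwards, the derivative being a multiple of the previous Hermite
  -- polynomial.
  have hX : ∀ p ∈ Submodule.span ℝ (Set.range hermiteH),
      X * p ∈ Submodule.span ℝ (Set.range hermiteH) := by
    intro p hp
    induction hp using Submodule.span_induction with
    | mem p hp =>
      obtain ⟨l, rfl⟩ := hp
      have key : X * hermiteH l =
          (1 / 2 : ℝ) • hermiteH (l + 1) + (1 / 2 : ℝ) • derivative (hermiteH l) := by
        rw [hermiteH, ← smul_add, sub_add_cancel, mul_assoc, ← C_ofNat, ← smul_eq_C_mul,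
          smul_smul]
        norm_num
      rw [key]
      refine add_mem (Submodule.smul_mem _ _ (Submodule.subset_span ⟨_, rfl⟩))
        (Submodule.smul_mem _ _ ?_)
      cases l with
      | zero => simp [hermiteH]
      | succ l =>
        rw [derivative_hermiteH_succ]
        exact Submodule.smul_mem _ _ (Submodule.subset_span ⟨_, rfl⟩)
    | zero => simp
    | add p q _ _ hp hq => rw [mul_add]; exact add_mem hp hq
    | smul a p _ hp => rw [mul_smul_comm]; exact Submodule.smul_mem _ _ hp
  refine eq_top_iff.2 fun p _ => ?_
  rw [p.as_sum_range_C_mul_X_pow]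
  refine Submodule.sum_mem _ fun n hn => ?_
  clear hn
  rw [← smul_eq_C_mul]
  refine Submodule.smul_mem _ _ ?_
  induction n with
  | zero => exact Submodule.subset_span ⟨0, by simp [hermiteH]⟩
  | succ n ih => rw [pow_succ']; exact hX _ ih

/-! ### Orthogonality -/

theorem integrable_eval_mul_exp_neg_mul_sq {b : ℝ} (hb : 0 < b) (p : ℝ[X]) :
    Integrable fun x : ℝ => p.eval x * Real.exp (-b * x ^ 2) := by
  induction p using Polynomial.induction_on' with
  | add p q hp hq =>
    simp only [eval_add, add_mul]
    exact hp.add hq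
  | monomial n a =>
    have := integrable_rpow_mul_exp_neg_mul_sq hb (s := n) (by
      have : (0 : ℝ) ≤ n := n.cast_nonneg
      linarith)
    simpa [mul_assoc] using this.const_mul a

/-- Integration by parts against the Gaussian weight. -/
theorem integral_eval_derivative_sub (p : ℝ[X]) :
    ∫ x : ℝ, (derivative p - 2 * X * p).eval x * Real.exp (-1 * x ^ 2) = 0 := by
  refine integral_eq_zero_of_hasDerivAt_of_integrable
    (f := fun x => p.eval x * Real.exp (-1 * x ^ 2)) (fun x => ?_)
    (integrable_eval_mul_exp_neg_mul_sq one_pos _) (integrable_eval_mul_exp_neg_mul_sq one_pos _)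
  have h := (p.hasDerivAt x).mul (((hasDerivAt_pow 2 x).const_mul (-1)).exp)
  refine h.congr_deriv ?_
  simp
  ring

/-- By the recursion, p' Hₙ - p Hₙ₊₁ = (p Hₙ)' - 2X p Hₙ, whose Gaussian integral is zero. -/
theorem integral_mul_hermiteH_succ (p : ℝ[X]) (n : ℕ) :
    ∫ x : ℝ, (p * hermiteH (n + 1)).eval x * Real.exp (-1 * x ^ 2) =
      ∫ x : ℝ, (derivative p * hermiteH n).eval x * Real.exp (-1 * x ^ 2) := by
  rw [← sub_eq_zero, ← integral_sub (integrable_eval_mul_exp_neg_mul_sq one_pos _)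
    (integrable_eval_mul_exp_neg_mul_sq one_pos _), ← neg_eq_zero, ← integral_neg]
  refine Eq.trans ?_ (integral_eval_derivative_sub (p * hermiteH n))
  congr 1 with x
  simp [hermiteH]
  ring

/-- Integration by parts lowers both indices by one at the cost of a factor 2(k + 1). The diagonal
ends at the Gaussian integral √π; off it, one index reaches 0 first and the derivative of H₀ = 1
kills the integral. -/
theorem integral_hermiteH_mul_hermiteH (k n : ℕ) :
    ∫ x : ℝ, (hermiteH k * hermiteH n).eval x * Real.exp (-1 * x ^ 2) =
      if k = n then 2 ^ n * (n.factorial : ℝ) * √Real.pi else 0 := by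
  have hzero : ∀ k,
      ∫ x : ℝ, (hermiteH (k + 1) * hermiteH 0).eval x * Real.exp (-1 * x ^ 2) = 0 := by
    intro k
    rw [mul_comm, integral_mul_hermiteH_succ]
    simp [hermiteH]
  induction n generalizing k with
  | zero =>
    cases k with
    | zero => simpa [hermiteH] using integral_gaussian 1
    | succ k => simpa using hzero k
  | succ n ih =>
    cases k with
    | zero => rw [mul_comm, hzero, if_neg (by simp)]
    | succ k =>
      rw [integral_mul_hermiteH_succ, derivative_hermiteH_succ]
      simp only [smul_mul_assoc, eval_smul, smul_eq_mul, mul_assoc, integral_const_mul] at ih ⊢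
      rw [ih k]
      by_cases h : k = n
      · subst h
        simp [Nat.factorial_succ, pow_succ]
        ring
      · simp [h]

end Hermite

/-! ### Hermite functions as a Hilbert basis of `L²(ℝ)` -/

section HermiteFunction

open Polynomial

/-- The normalized Hermite function of inverse length scale `c`. -/
def hermiteFunction (c : ℝ) (l : ℕ) (x : ℝ) : ℝ :=
  √(c / √Real.pi * (1 / (2 ^ l * (l.factorial : ℝ)))) * Real.exp (-(c * x) ^ 2 / 2) *
    (hermiteH l).eval (c * x)

theorem oscillator_eq_hermiteFunction {m ω ħ ξ : ℝ} (h : 0 < m * ω / (ħ * ξ)) :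
    oscillator m ω ħ ξ = hermiteFunction (√(m * ω / (ħ * ξ))) := by
  have : m * ω / (Real.pi * ħ * ξ) = m * ω / (ħ * ξ) / Real.pi := by
    rw [div_div]
    ring_nf
  funext l x
  rw [oscillator, hermiteFunction, this, Real.sqrt_div h.le]

variable {c : ℝ}

theorem memLp_eval_mul_exp (hc : 0 < c) (p : ℝ[X]) :
    MemLp (fun x : ℝ => p.eval (c * x) * Real.exp (-(c * x) ^ 2 / 2)) 2 := by
  rw [memLp_two_iff_integrable_sq (Continuous.aestronglyMeasurable (by fun_prop))]
  refine ((integrable_eval_mul_exp_neg_mul_sq one_pos (p ^ 2)).comp_mul_left' hc.ne').congr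
    (.of_forall fun x => ?_)
  simp only [eval_pow, mul_pow, ← Real.exp_nat_mul]
  congr 2
  push_cast
  ring

theorem hermiteFunction_eq (c : ℝ) (l : ℕ) : hermiteFunction c l = fun x =>
    √(c / √Real.pi * (1 / (2 ^ l * (l.factorial : ℝ)))) *
      ((hermiteH l).eval (c * x) * Real.exp (-(c * x) ^ 2 / 2)) := by
  funext x
  rw [hermiteFunction]
  ring

theorem memLp_hermiteFunction (hc : 0 < c) (l : ℕ) : MemLp (hermiteFunction c l) 2 := by
  rw [hermiteFunction_eq]
  exact (memLp_eval_mul_exp hc _).const_mul _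

/-- Substituting y = cx, the Jacobian 1/c and the factor 2ⁿ n! √π cancel against the normalization.
-/
theorem integral_hermiteFunction_mul (hc : 0 < c) (k n : ℕ) :
    ∫ x, hermiteFunction c k x * hermiteFunction c n x = if k = n then 1 else 0 := by
  have h : ∀ x, hermiteFunction c k x * hermiteFunction c n x =
      √(c / √Real.pi * (1 / (2 ^ k * (k.factorial : ℝ)))) *
      √(c / √Real.pi * (1 / (2 ^ n * (n.factorial : ℝ)))) *
      (fun y => (hermiteH k * hermiteH n).eval y * Real.exp (-1 * y ^ 2)) (c * x) := by
    intro x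
    have : Real.exp (-1 * (c * x) ^ 2) =
        Real.exp (-(c * x) ^ 2 / 2) * Real.exp (-(c * x) ^ 2 / 2) := by
      rw [← Real.exp_add]
      ring_nf
    simp only [this, hermiteFunction, eval_mul]
    ring
  rw [integral_congr_ae (.of_forall h), integral_const_mul,
    Measure.integral_comp_mul_left
      (fun y => (hermiteH k * hermiteH n).eval y * Real.exp (-1 * y ^ 2)) c,
    integral_hermiteH_mul_hermiteH]
  split_ifs with hkn
  · subst hkn
    rw [Real.mul_self_sqrt (by positivity), abs_of_pos (by positivity), smul_eq_mul]
    have : √Real.pi ≠ 0 := by positivity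
    field_simp
  · simp

/-- Paired with a square-integrable r, this gives the exponential moments of the Gaussian times r.
The square is exp(-c²x² + 2tx). -/
theorem memLp_exp_mul_gaussian (hc : 0 < c) (t : ℝ) :
    MemLp (fun x : ℝ => Real.exp (t * x) * Real.exp (-(c * x) ^ 2 / 2)) 2 := by
  rw [memLp_two_iff_integrable_sq (Continuous.aestronglyMeasurable (by fun_prop))]
  refine (integrable_cexp_quadratic (b := (c ^ 2 : ℝ)) (by
    rw [Complex.ofReal_re]
    positivity)
    (2 * t : ℝ) 0).norm.congr (.of_forall fun x => ?_)
  simp only [← Real.exp_add, ← Real.exp_nat_mul, Complex.norm_exp]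
  norm_cast
  simp only [add_zero]
  congr 1
  ring

/-- A square-integrable real function orthogonal to all Hermite functions vanishes. -/
theorem ae_eq_zero_of_integral_hermiteFunction_mul_eq_zero (hc : 0 < c) {r : ℝ → ℝ}
    (hr : MemLp r 2) (h : ∀ l, ∫ x, hermiteFunction c l x * r x = 0) : r =ᵐ[volume] 0 := by
  have hp : ∀ p : ℝ[X],
      ∫ x, (p.eval (c * x) * Real.exp (-(c * x) ^ 2 / 2)) * r x = 0 := by
    intro p
    have hp : p ∈ Submodule.span ℝ (Set.range hermiteH) := span_hermiteH ▸ Submodule.mem_top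
    induction hp using Submodule.span_induction with
    | mem p hp =>
      obtain ⟨l, rfl⟩ := hp
      have := h l
      rw [hermiteFunction_eq] at this
      simp only [mul_assoc, integral_const_mul] at this ⊢
      exact (mul_eq_zero.1 this).resolve_left (by positivity)
    | zero => simp
    | add p q _ _ hp hq =>
      have hs := integral_add ((memLp_eval_mul_exp hc p).integrable_mul hr)
        ((memLp_eval_mul_exp hc q).integrable_mul hr)
      simp only [Pi.mul_apply, hp, hq, add_zero] at hs
      rw [← hs]
      congr 1 with x
      simp
      ring
    | smul a p _ hp =>
      simp only [eval_smul, smul_eq_mul, mul_assoc, integral_const_mul] at hp ⊢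
      rw [hp, mul_zero]
  have hz := ae_eq_zero_of_moments_eq_zero
    (g := fun x => Real.exp (-(c * x) ^ 2 / 2) * r x)
    (fun t => by
      simp only [← mul_assoc]
      exact (memLp_exp_mul_gaussian hc t).integrable_mul hr)
    (fun n => by
      -- The factor c⁻ⁿ undoes the dilation: this polynomial takes the value xⁿ at cx.
      refine Eq.trans ?_ (hp (C (c⁻¹ ^ n) * X ^ n))
      congr 1 with x
      have : c⁻¹ ^ n * (c * x) ^ n = x ^ n := by rw [← mul_pow, inv_mul_cancel_left₀ hc.ne']
      simp only [eval_mul, eval_C, eval_pow, eval_X, this]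
      ring)
  filter_upwards [hz] with x hx
  exact (mul_eq_zero.1 hx).resolve_left (Real.exp_pos _).ne'

/-- The Hermite function as an element of the complex space `L²(ℝ)`. -/
def hermiteLp (hc : 0 < c) (l : ℕ) : Lp ℂ 2 (volume : Measure ℝ) :=
  (memLp_hermiteFunction hc l).ofReal.toLp (fun x => (hermiteFunction c l x : ℂ))

theorem coeFn_hermiteLp (hc : 0 < c) (l : ℕ) :
    hermiteLp hc l =ᵐ[volume] fun x => (hermiteFunction c l x : ℂ) :=
  MemLp.coeFn_toLp _

theorem orthonormal_hermiteLp (hc : 0 < c) : Orthonormal ℂ (hermiteLp hc) := by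
  rw [orthonormal_iff_ite]
  intro k n
  rw [L2.inner_def]
  calc _ = ∫ x, ((hermiteFunction c k x * hermiteFunction c n x : ℝ) : ℂ) := by
        refine integral_congr_ae ?_
        filter_upwards [coeFn_hermiteLp hc k, coeFn_hermiteLp hc n] with x h₁ h₂
        rw [h₁, h₂, RCLike.inner_apply', Complex.conj_ofReal, Complex.ofReal_mul]
    _ = _ := by
        rw [integral_complex_ofReal, integral_hermiteFunction_mul hc]
        split_ifs <;> simp

/-- Hermite functions are real, so the real and imaginary parts of f are separately orthogonal to
them. -/
theorem orthogonal_span_hermiteLp (hc : 0 < c) :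
    (Submodule.span ℂ (Set.range (hermiteLp hc)))ᗮ = ⊥ := by
  refine (Submodule.eq_bot_iff _).2 fun f hf => ?_
  have hL : MemLp f 2 := Lp.memLp f
  have hi : ∀ l, Integrable fun x => (hermiteFunction c l x : ℂ) * f x := fun l =>
    (memLp_hermiteFunction hc l).ofReal.integrable_mul hL
  have h : ∀ l, ∫ x, (hermiteFunction c l x : ℂ) * f x = 0 := by
    intro l
    have := Submodule.inner_right_of_mem_orthogonal
      (Submodule.subset_span (Set.mem_range_self l)) hf
    rw [L2.inner_def] at this
    rw [← this]
    refine integral_congr_ae ?_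
    filter_upwards [coeFn_hermiteLp hc l] with x hx
    rw [hx, RCLike.inner_apply', Complex.conj_ofReal]
  have hre := ae_eq_zero_of_integral_hermiteFunction_mul_eq_zero hc hL.re fun l => by
    have := integral_re (hi l)
    rw [h l] at this
    simpa using this
  have him := ae_eq_zero_of_integral_hermiteFunction_mul_eq_zero hc hL.im fun l => by
    have := integral_im (hi l)
    rw [h l] at this
    simpa using this
  rw [Lp.eq_zero_iff_ae_eq_zero]
  filter_upwards [hre, him] with x h₁ h₂
  exact Complex.ext h₁ h₂

/-- The Hilbert basis of `L²(ℝ)` formed by the Hermite functions. -/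
def hermiteBasis (hc : 0 < c) : HilbertBasis ℕ ℂ (Lp ℂ 2 (volume : Measure ℝ)) :=
  HilbertBasis.mkOfOrthogonalEqBot (orthonormal_hermiteLp hc) (orthogonal_span_hermiteLp hc)

end HermiteFunction

/-! ### From Hilbert bases to the bicomplex oscillator basis -/

theorem existsUnique_isExpansion (b : HilbertBasis ℕ ℂ (Lp ℂ 2 (volume : Measure ℝ)))
    (f : Lp ℂ 2 (volume : Measure ℝ)) : ∃! a, IsExpansion b a f := by
  refine ⟨fun l => b.repr f l, (b.hasSum_repr f).tendsto_sum_nat, fun a ha => funext fun k => ?_⟩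
  rw [b.repr_apply_apply]
  refine tendsto_nhds_unique ?_ (Tendsto.inner tendsto_const_nhds ha)
  -- Once N > k, the inner product of `b k` with the N-th partial sum is constantly `a k`.
  refine tendsto_const_nhds.congr' ?_
  filter_upwards [eventually_gt_atTop k] with N hN
  rw [inner_sum, Finset.sum_eq_single k]
  · simp [inner_smul_right, b.orthonormal.1 k]
  · intro l _ hl
    rw [inner_smul_right, b.orthonormal.2 hl.symm, mul_zero]
  · intro hk
    exact absurd (Finset.mem_range.2 hN) hk

/-- An invertible element of `𝔻⁺` has positive real components. -/
theorem pos_of_mem_Dplus_of_isUnit {ξ : Bicomplex} (hξ : ξ ∈ Dplus) (hu : IsUnit ξ) :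
    0 < (P₁ ξ).re ∧ 0 < (P₂ ξ).re := by
  obtain ⟨η, hη⟩ := hu.exists_right_inv
  obtain ⟨x₁, x₂, h₁, h₂, rfl⟩ := hξ
  have hη₁ := congrArg P₁ hη
  have hη₂ := congrArg P₂ hη
  rw [P₁_mul, P₁_idem, P₁_one] at hη₁
  rw [P₂_mul, P₂_idem, P₂_one] at hη₂
  rw [P₁_idem, P₂_idem, Complex.ofReal_re, Complex.ofReal_re]
  refine ⟨h₁.lt_of_ne' ?_, h₂.lt_of_ne' ?_⟩
  · rintro rfl
    simp at hη₁
  · rintro rfl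
    simp at hη₂

theorem exists_isSchauderBasis_bicomplexOscillator {m ω ħ : ℝ} {ξ : Bicomplex} (hm : 0 < m)
    (hω : 0 < ω) (hħ : 0 < ħ) (hξ : ξ ∈ Dplus) (hu : IsUnit ξ) :
    ∃ φ : ℕ → L2Module,
      (∀ l, ((φ l : ℝ →ₘ[volume] Bicomplex) : ℝ → Bicomplex) =ᵐ[volume]
        bicomplexOscillator m ω ħ ξ l) ∧
      IsSchauderBasis (inducedNorm integralProduct) φ := by
  obtain ⟨hξ₁, hξ₂⟩ := pos_of_mem_Dplus_of_isUnit hξ hu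
  have hq₁ : 0 < m * ω / (ħ * (P₁ ξ).re) := by positivity
  have hq₂ : 0 < m * ω / (ħ * (P₂ ξ).re) := by positivity
  have hc₁ := Real.sqrt_pos.2 hq₁
  have hc₂ := Real.sqrt_pos.2 hq₂
  -- The two components use Hermite bases of possibly different scales √(mω/(ħξₖ)); nothing couples
  -- them.
  choose φ hφ using fun l => exists_comp_eq (WithLp.toLp 2 (hermiteLp hc₁ l, hermiteLp hc₂ l))
  refine ⟨φ, fun l => ?_, isSchauderBasis_of_components (fun f => ?_) (fun f => ?_)⟩
  · have h := coeFn_eq_comp (φ l)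
    rw [hφ l] at h
    filter_upwards [h, coeFn_hermiteLp hc₁ l, coeFn_hermiteLp hc₂ l] with x hx h₁ h₂
    rw [hx, bicomplexOscillator, oscillator_eq_hermiteFunction hq₁,
      oscillator_eq_hermiteFunction hq₂, ← h₁, ← h₂]
    rfl
  · have h := existsUnique_isExpansion (hermiteBasis hc₁) f
    rw [hermiteBasis, HilbertBasis.coe_mkOfOrthogonalEqBot] at h
    simp only [hφ]
    exact h
  · have h := existsUnique_isExpansion (hermiteBasis hc₂) f
    rw [hermiteBasis, HilbertBasis.coe_mkOfOrthogonalEqBot] at h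
    simp only [hφ]
    exact h

end

end Bicomplex

theorem mainTheorem10 :
    (∀ u v : Bicomplex.L2Module, Integrable (fun x : ℝ =>
      Bicomplex.conj₃ ((u : ℝ →ₘ[volume] Bicomplex) x) * (v : ℝ →ₘ[volume] Bicomplex) x)) ∧
    Bicomplex.IsHilbert Bicomplex.integralProduct ∧
    ∀ (m ω ħ : ℝ) (ξ : Bicomplex), 0 < m → 0 < ω → 0 < ħ → ξ ∈ Bicomplex.Dplus → IsUnit ξ →
      ∃ φ : ℕ → Bicomplex.L2Module,
        (∀ l, ((φ l : ℝ →ₘ[volume] Bicomplex) : ℝ → Bicomplex) =ᵐ[volume]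
          Bicomplex.bicomplexOscillator m ω ħ ξ l) ∧
        Bicomplex.IsSchauderBasis (Bicomplex.inducedNorm Bicomplex.integralProduct) φ :=
  ⟨Bicomplex.integrable_integrand, Bicomplex.isHilbert_integralProduct,
    fun _ _ _ _ hm hω hħ hξ hu =>
      Bicomplex.exists_isSchauderBasis_bicomplexOscillator hm hω hħ hξ hu⟩
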